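/- Let $m,n\ge 1$ be integers. Identify operators on $\mathbb{C}^m\otimes\mathbb{C}^n$ with $mn\times mn$ complex matrices. A product vector is a vector of the form $a\otimes b$ with $a\in\mathbb{C}^m$, $b\in\mathbb{C}^n$; a pure entangled state is a nonzero (not necessarily normalized) vector that is not a product vector. An entanglement witness (EW) on $\mathbb{C}^m\otimes\mathbb{C}^n$ is a Hermitian operator $W$ that is not positive semidefinite and satisfies $\langle\psi|W|\psi\rangle\ge 0$ for every product vector $\psi$. It is decomposable if $W=P+Q^{\Gamma}$ with $P,Q$ positive semidefinite, where $Q^\Gamma$ is the partial transpose of $Q$ with respect to the first tensor factor. The negative eigenspace of $W$ is the span of its eigenvectors with negative eigenvalues, the zero eigenspace is $\ker W$, and the non-positive eigenspace is the sum of the two. Numbers of eigenvalues are counted with multiplicity. Let $W$ be an EW on $\mathbb{C}^m\otimes\mathbb{C}^n$. (i) Every product vector in the non-positive eigenspace of $W$ lies in the zero eigenspace of $W$. In particular, every nonzero vector in the negative eigenspace of $W$ is a pure entangled state. (ii) The number of negative eigenvalues of $W$ lies in $[1,(m-1)(n-1)]$. Moreover, for all $m,n\ge 2$ there exists a decomposable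 EW on $\mathbb{C}^m\otimes\mathbb{C}^n$ with exactly $(m-1)(n-1)$ negative eigenvalues. (iii) The number of positive eigenvalues of $W$ lies in $[2,mn-1]$. -/

import Mathlib

/-! Operators on `ℂ^m ⊗ ℂ^n` are matrices indexed by `Fin m × Fin n`, vectors of `ℂ^m ⊗ ℂ^n` are
functions `Fin m × Fin n → ℂ` (coordinates in the product of the standard bases). -/

open scoped ComplexOrder

namespace EntWit

/-- Operators on `ℂ^m ⊗ ℂ^n`. -/
abbrev Op (m n : ℕ) : Type := Matrix (Fin m × Fin n) (Fin m × Fin n) ℂ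

/-- The elementary tensor `a ⊗ b`. -/
def tensorVec {m n : ℕ} (a : Fin m → ℂ) (b : Fin n → ℂ) : Fin m × Fin n → ℂ :=
  fun p => a p.1 * b p.2

/-- `v` is a product vector: `v = a ⊗ b` for some `a ∈ ℂ^m`, `b ∈ ℂ^n`. -/
def IsProductVector {m n : ℕ} (v : Fin m × Fin n → ℂ) : Prop :=
  ∃ (a : Fin m → ℂ) (b : Fin n → ℂ), v = tensorVec a b

/-- `v` is a (non-normalized) pure entangled state: a nonzero vector that is not a product
vector. -/
def IsPureEntangled {m n : ℕ} (v : Fin m × Fin n → ℂ) : Prop :=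
  v ≠ 0 ∧ ¬ IsProductVector v

/-- `W` is an entanglement witness: Hermitian, not positive semidefinite, and with nonnegative
expectation `⟨ψ|W|ψ⟩` in every product vector `ψ` (a real number, as `W` is Hermitian). -/
structure IsEntanglementWitness {m n : ℕ} (W : Op m n) : Prop where
  isHermitian : W.IsHermitian
  not_posSemidef : ¬ W.PosSemidef
  product_nonneg : ∀ v : Fin m × Fin n → ℂ, IsProductVector v →
    0 ≤ (dotProduct (star v) (Matrix.mulVec W v)).re

/-- The partial transpose with respect to the first tensor factor. -/
def partialTranspose {m n : ℕ} (Q : Op m n) : Op m n :=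
  Matrix.of fun p q => Q (q.1, p.2) (p.1, q.2)

/-- `W` is decomposable: `W = P + Q^Γ` with `P` and `Q` positive semidefinite. -/
def IsDecomposable {m n : ℕ} (W : Op m n) : Prop :=
  ∃ P Q : Op m n, P.PosSemidef ∧ Q.PosSemidef ∧ W = P + partialTranspose Q

/-- The span of the eigenvectors of `W` with negative eigenvalues. -/
noncomputable def negEigenspace {m n : ℕ} (W : Op m n) : Submodule ℂ (Fin m × Fin n → ℂ) :=
  ⨆ μ : {μ : ℝ // μ < 0}, Module.End.eigenspace (Matrix.toLin' W) ((μ : ℝ) : ℂ)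

/-- The eigenspace of `W` for the eigenvalue `0`, i.e. its kernel. -/
noncomputable def zeroEigenspace {m n : ℕ} (W : Op m n) : Submodule ℂ (Fin m × Fin n → ℂ) :=
  Module.End.eigenspace (Matrix.toLin' W) 0

/-- The non-positive eigenspace of `W`: the sum of the negative and the zero eigenspaces. -/
noncomputable def nonposEigenspace {m n : ℕ} (W : Op m n) : Submodule ℂ (Fin m × Fin n → ℂ) :=
  negEigenspace W ⊔ zeroEigenspace W

/-- The number of negative eigenvalues of a Hermitian operator, counted with multiplicity. -/
noncomputable def numNegEigenvalues {m n : ℕ} {W : Op m n} (hW : W.IsHermitian) : ℕ :=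
  Nat.card {i : Fin m × Fin n // hW.eigenvalues i < 0}

/-- The number of positive eigenvalues of a Hermitian operator, counted with multiplicity. -/
noncomputable def numPosEigenvalues {m n : ℕ} {W : Op m n} (hW : W.IsHermitian) : ℕ :=
  Nat.card {i : Fin m × Fin n // 0 < hW.eigenvalues i}

end EntWit

/-! In an orthonormal eigenbasis, `⟨v|W|v⟩ = ∑ λ_i |c_i|²`. If `v` has no positive part and
nonnegative expectation, every term vanishes; this gives (i). The bound on negative eigenvalues is
dimension theory: the cone of matrices of rank at most one has dimension `m + n - 1`, so `m + n - 2`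
linear forms always share a nonzero zero on it (`exists_rank_one_common_zero`). With more than
`(m-1)(n-1)` negative eigenvalues, orthogonality to the remaining eigenvectors is so few conditions
that a nonzero product vector lies in the negative eigenspace. With at most one positive eigenvalue,
every coordinate functional at a negative eigenvalue vanishes on the product vectors killed by a
single functional `β`, hence is a multiple of it (`exists_eq_smul_of_vanish_on_product`), which is
impossible. For sharpness, a positive definite Gram matrix of moments has a partial transpose that
annihilates all vectors with zero antidiagonal sums. Subtracting a small `ε` from it before
transposing makes these `(m-1)(n-1)` dimensions negative. -/

namespace EntWit

/-! ### Dimension theory of the cone of rank-one matrices. -/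

section Segre

variable {K : Type*} [Field K] {m n : ℕ}

/-- The homomorphism `z_ij ↦ x_i y_j` whose image is the coordinate ring of the cone of matrices
of rank at most one. -/
noncomputable def segre (K : Type*) [Field K] (m n : ℕ) :
    MvPolynomial (Fin m × Fin n) K →ₐ[K] MvPolynomial (Fin m ⊕ Fin n) K :=
  MvPolynomial.aeval fun p => MvPolynomial.X (Sum.inl p.1) * MvPolynomial.X (Sum.inr p.2)

/-- The homomorphism setting the variables in `T` to zero. -/
noncomputable def killVars (K : Type*) [Field K] {σ : Type*} [DecidableEq σ] (T : Finset σ) :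
    MvPolynomial σ K →ₐ[K] MvPolynomial σ K :=
  MvPolynomial.aeval fun v => if v ∈ T then 0 else MvPolynomial.X v

lemma killVars_comp_of_subset {σ : Type*} [DecidableEq σ] {T T' : Finset σ} (h : T ⊆ T') :
    (killVars K T').comp (killVars K T) = killVars K T' := by
  refine MvPolynomial.algHom_ext fun v => ?_
  by_cases hv : v ∈ T
  · simp [killVars, hv, h hv]
  · simp [killVars, hv]

/-- The ideal of the rank-at-most-one matrices `(x_i y_j)` where the variables in `T` vanish. -/
noncomputable def segrePrime (K : Type*) [Field K] {m n : ℕ} (T : Finset (Fin m ⊕ Fin n)) :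
    Ideal (segre K m n).range :=
  RingHom.ker ((killVars K T).comp (segre K m n).range.val)

instance (T : Finset (Fin m ⊕ Fin n)) : (segrePrime K T).IsPrime :=
  RingHom.ker_isPrime _

lemma mem_segrePrime {T : Finset (Fin m ⊕ Fin n)} {r : (segre K m n).range} :
    r ∈ segrePrime K T ↔ killVars K T (r : MvPolynomial (Fin m ⊕ Fin n) K) = 0 :=
  Iff.rfl

lemma rangeRestrict_X_mem_segrePrime {T : Finset (Fin m ⊕ Fin n)} (i : Fin m) (j : Fin n) :
    (segre K m n).rangeRestrict (MvPolynomial.X (i, j)) ∈ segrePrime K T ↔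
      Sum.inl i ∈ T ∨ Sum.inr j ∈ T := by
  change killVars K T (segre K m n (MvPolynomial.X (i, j))) = 0 ↔ _
  by_cases hi : Sum.inl i ∈ T <;> by_cases hj : Sum.inr j ∈ T <;>
    simp [segre, killVars, hi, hj]

lemma segrePrime_mono {T T' : Finset (Fin m ⊕ Fin n)} (h : T ⊆ T') :
    segrePrime K T ≤ segrePrime K T' := by
  intro r hr
  rw [mem_segrePrime] at hr ⊢
  rw [← killVars_comp_of_subset h, AlgHom.comp_apply, hr, map_zero]

lemma segrePrime_lt {T T' : Finset (Fin m ⊕ Fin n)} (h : T ⊆ T') (i : Fin m) (j : Fin n)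
    (hT : Sum.inl i ∉ T ∧ Sum.inr j ∉ T) (hT' : Sum.inl i ∈ T' ∨ Sum.inr j ∈ T') :
    segrePrime K T < segrePrime K T' := by
  refine lt_of_le_not_ge (segrePrime_mono h) fun hle => ?_
  have := hle ((rangeRestrict_X_mem_segrePrime i j).2 hT')
  rw [rangeRestrict_X_mem_segrePrime] at this
  tauto

/-- Killing the variables of `T` one at a time gives a strict chain of primes: as `x_i` and `y_j`
survive, the loss of `x_k` is detected by `x_k y_j` and that of `y_l` by `x_i y_l`. -/
lemma card_le_height_segrePrime (i : Fin m) (j : Fin n) (T : Finset (Fin m ⊕ Fin n))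
    (hi : Sum.inl i ∉ T) (hj : Sum.inr j ∉ T) : (T.card : ℕ∞) ≤ (segrePrime K T).height := by
  induction T using Finset.induction_on with
  | empty => simp
  | insert v T hv ih =>
    rw [Finset.mem_insert, not_or] at hi hj
    have hlt : segrePrime K T < segrePrime K (insert v T) := by
      rcases v with k | l
      · exact segrePrime_lt (Finset.subset_insert _ _) k j ⟨hv, hj.2⟩ (by simp)
      · exact segrePrime_lt (Finset.subset_insert _ _) i l ⟨hi.2, hv⟩ (by simp)
    have := Ideal.height_add_one_le_of_lt_of_isPrime hlt
    rw [Finset.card_insert_of_notMem hv]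
    push_cast
    exact (add_le_add_left (ih hi.2 hj.2) 1).trans this

/-- The vertex of the cone of matrices of rank at most one has height at least `m + n - 1`. -/
lemma add_le_height_segrePrime_univ (hm : 0 < m) (hn : 0 < n) :
    ((m + n : ℕ) : ℕ∞) ≤ (segrePrime K (Finset.univ : Finset (Fin m ⊕ Fin n))).height + 1 := by
  let i : Fin m := ⟨0, hm⟩
  let j : Fin n := ⟨0, hn⟩
  -- The chain has `m + n - 2` steps up to `T`; one last step kills `x_i` and `y_j` together, since
  -- either alone already kills `x_i y_j`.
  let T : Finset (Fin m ⊕ Fin n) := (Finset.univ.erase (Sum.inl i)).erase (Sum.inr j)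
  have hcard : T.card + 2 = m + n := by
    have h1 : T.card = m + n - 1 - 1 := by
      rw [Finset.card_erase_of_mem (by simp), Finset.card_erase_of_mem (by simp)]
      simp
    omega
  have hT := card_le_height_segrePrime (K := K) i j T (by simp [T]) (by simp [T])
  have hlt := segrePrime_lt (K := K) (Finset.subset_univ T) i j (by simp [T]) (by simp)
  have h2 := Ideal.height_add_one_le_of_lt_of_isPrime hlt
  calc ((m + n : ℕ) : ℕ∞) = T.card + 1 + 1 := by rw [← hcard]; push_cast; ring
    _ ≤ _ := by gcongr; exact (add_le_add_left hT 1).trans h2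

/-- If all 2 × 2 minors of a nonzero matrix vanish, it is an outer product. -/
lemma exists_eq_mul_of_minors {z : Fin m × Fin n → K} (hz : z ≠ 0)
    (h : ∀ i j k l, z (i, j) * z (k, l) = z (i, l) * z (k, j)) :
    ∃ (a : Fin m → K) (b : Fin n → K), ∀ p, z p = a p.1 * b p.2 := by
  obtain ⟨⟨i, j⟩, hij⟩ := Function.ne_iff.1 hz
  rw [Pi.zero_apply] at hij
  refine ⟨fun k => z (k, j), fun l => z (i, l) / z (i, j), fun p => ?_⟩
  have := h i j p.1 p.2
  field_simp
  linear_combination this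

/-- At most `m + n - 2` linear forms on the `m × n` matrices over an algebraically closed field
have a common zero of rank one. -/
theorem exists_rank_one_common_zero [IsAlgClosed K] {ι : Type*} [Fintype ι] (hm : 0 < m)
    (hn : 0 < n) (hι : Fintype.card ι + 2 ≤ m + n) (f : ι → Fin m × Fin n → K) :
    ∃ (a : Fin m → K) (b : Fin n → K), (fun p : Fin m × Fin n => a p.1 * b p.2) ≠ 0 ∧
      ∀ k, ∑ p, f k p * (a p.1 * b p.2) = 0 := by
  classical
  let φ := (segre K m n).rangeRestrict
  have hφ : Function.Surjective φ := (segre K m n).rangeRestrict_surjective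
  have : IsNoetherianRing (segre K m n).range :=
    isNoetherianRing_of_surjective _ _ φ.toRingHom hφ
  let F : ι → MvPolynomial (Fin m × Fin n) K := fun k =>
    ∑ p, MvPolynomial.C (f k p) * MvPolynomial.X p
  let s : Finset (segre K m n).range := Finset.univ.image fun k => φ (F k)
  have hs : Ideal.span (s : Set (segre K m n).range) ≤ segrePrime K Finset.univ := by
    rw [Ideal.span_le]
    intro r hr
    obtain ⟨k, -, rfl⟩ := Finset.mem_image.1 (Finset.mem_coe.1 hr)
    simp only [F, map_sum, map_mul]
    exact Ideal.sum_mem _ fun p _ => Ideal.mul_mem_left _ _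
      ((rangeRestrict_X_mem_segrePrime p.1 p.2).2 (by simp))
  obtain ⟨q, hq, -⟩ := Ideal.exists_minimalPrimes_le hs
  have hqp : q.IsPrime := hq.isPrime
  -- Krull's height theorem: `q` has height at most the number of forms.
  have hqh := Ideal.height_le_card_of_mem_minimalPrimes_span_finset hq
  have hF : ∀ k, φ (F k) ∈ q := fun k =>
    hq.1.2 (Ideal.subset_span (Finset.mem_coe.2 (Finset.mem_image_of_mem _ (Finset.mem_univ k))))
  have hvan := MvPolynomial.IsPrime.vanishingIdeal_zeroLocus (K := K) (q.comap φ)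
  obtain ⟨z, hzq, hz⟩ : ∃ z ∈ MvPolynomial.zeroLocus K (q.comap φ), z ≠ 0 := by
    -- If the origin were the only zero of `q`, the Nullstellensatz `hvan` would put the whole
    -- vertex ideal inside `q`, whose height is too small.
    by_contra! hcon
    have hle : segrePrime K Finset.univ ≤ q := by
      intro r hr
      obtain ⟨g, rfl⟩ := hφ r
      rw [← Ideal.mem_comap, ← hvan, MvPolynomial.mem_vanishingIdeal_iff]
      intro z hz
      rw [hcon z hz]
      have h0 : MvPolynomial.aeval (0 : Fin m ⊕ Fin n → K)
          (killVars K Finset.univ (segre K m n g)) = 0 := by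
        have : killVars K Finset.univ (segre K m n g) = 0 := hr
        rw [this, map_zero]
      have hcomp : ((MvPolynomial.aeval (0 : Fin m ⊕ Fin n → K)).comp
          ((killVars K Finset.univ).comp (segre K m n))) =
          MvPolynomial.aeval (0 : Fin m × Fin n → K) :=
        MvPolynomial.algHom_ext fun p => by simp [killVars, segre]
      rw [← hcomp]
      exact h0
    have h1 := add_le_height_segrePrime_univ (K := K) hm hn
    have h2 : (segrePrime K (Finset.univ : Finset (Fin m ⊕ Fin n))).height ≤ Fintype.card ι :=
      (Ideal.height_mono hle).trans (hqh.trans (by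
        exact_mod_cast Finset.card_image_le))
    have h3 := h1.trans (add_le_add_left h2 1)
    have h4 : m + n ≤ Fintype.card ι + 1 := by exact_mod_cast h3
    omega
  rw [MvPolynomial.mem_zeroLocus_iff] at hzq
  -- The 2 × 2 minors lie in the kernel of `segre`, hence in the pullback of `q`, so they vanish at
  -- `z`.
  obtain ⟨a, b, hab⟩ := exists_eq_mul_of_minors hz fun i j k l => by
    have := hzq (MvPolynomial.X (i, j) * MvPolynomial.X (k, l) -
      MvPolynomial.X (i, l) * MvPolynomial.X (k, j)) (by
        rw [Ideal.mem_comap]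
        convert q.zero_mem
        apply Subtype.ext
        change segre K m n _ = 0
        simp only [segre, map_sub, map_mul, MvPolynomial.aeval_X]
        ring)
    simpa [sub_eq_zero] using this
  refine ⟨a, b, fun h => hz (funext fun p => (hab p).trans (congrFun h p)), fun k => ?_⟩
  simpa [F, hab] using hzq (F k) (hF k)

end Segre

/-! ### Hermitian forms in eigenbasis coordinates. -/

section EigenCoord

variable {ι : Type*} [Fintype ι] [DecidableEq ι] {W : Matrix ι ι ℂ}

/-- The coordinates of a vector in an orthonormal eigenbasis of a Hermitian matrix. -/
noncomputable def eigenCoord (hW : W.IsHermitian) : (ι → ℂ) →ₗ[ℂ] (ι → ℂ) :=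
  Matrix.mulVecLin (star (hW.eigenvectorUnitary : Matrix ι ι ℂ))

lemma eigenCoord_injective (hW : W.IsHermitian) : Function.Injective (eigenCoord hW) := by
  intro v w h
  have := congrArg (Matrix.mulVec (hW.eigenvectorUnitary : Matrix ι ι ℂ)) h
  simpa [eigenCoord, Matrix.mulVec_mulVec] using this

lemma eigenCoord_eq_sum (hW : W.IsHermitian) (v : ι → ℂ) (i : ι) :
    eigenCoord hW v i = ∑ p, star (hW.eigenvectorBasis i p) * v p := by
  simp [eigenCoord, Matrix.mulVec, dotProduct, Matrix.star_apply]

lemma eigenCoord_eigenvectorBasis (hW : W.IsHermitian) (i : ι) :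
    eigenCoord hW (hW.eigenvectorBasis i) = Pi.single i 1 :=
  hW.star_eigenvectorUnitary_mulVec i

lemma eigenCoord_mulVec (hW : W.IsHermitian) (v : ι → ℂ) (i : ι) :
    eigenCoord hW (W.mulVec v) i = hW.eigenvalues i * eigenCoord hW v i := by
  have h : star (hW.eigenvectorUnitary : Matrix ι ι ℂ) * W =
      Matrix.diagonal (RCLike.ofReal ∘ hW.eigenvalues) *
        star (hW.eigenvectorUnitary : Matrix ι ι ℂ) := by
    rw [← hW.conjStarAlgAut_star_eigenvectorUnitary, Unitary.conjStarAlgAut_star_apply,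
      mul_assoc, Unitary.mul_star_self_of_mem hW.eigenvectorUnitary.2, mul_one]
  have := congrFun (congrArg (fun M => Matrix.mulVec M v) h) i
  simp only [← Matrix.mulVec_mulVec, Matrix.mulVec_diagonal] at this
  simpa [eigenCoord] using this

lemma dotProduct_star_eq_eigenCoord (hW : W.IsHermitian) (v w : ι → ℂ) :
    star v ⬝ᵥ w = star (eigenCoord hW v) ⬝ᵥ eigenCoord hW w := by
  simp only [eigenCoord, Matrix.mulVecLin_apply]
  rw [Matrix.star_mulVec, Matrix.dotProduct_mulVec, Matrix.vecMul_vecMul,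
    ← Matrix.star_eq_conjTranspose, star_star,
    Unitary.mul_star_self_of_mem hW.eigenvectorUnitary.2, Matrix.vecMul_one]

lemma re_dotProduct_star_self {κ : Type*} [Fintype κ] (v : κ → ℂ) :
    (star v ⬝ᵥ v).re = ∑ i, Complex.normSq (v i) := by
  simp [dotProduct, Complex.normSq_apply]

lemma re_dotProduct_mulVec (hW : W.IsHermitian) (v : ι → ℂ) :
    (star v ⬝ᵥ W.mulVec v).re =
      ∑ i, hW.eigenvalues i * Complex.normSq (eigenCoord hW v i) := by
  rw [dotProduct_star_eq_eigenCoord hW, dotProduct, Complex.re_sum]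
  refine Finset.sum_congr rfl fun i _ => ?_
  rw [eigenCoord_mulVec]
  simp [Complex.normSq_apply]
  ring

/-- A vector in the nonpositive part of a Hermitian matrix, with nonnegative expectation, is
annihilated by the matrix. -/
lemma eigenvalues_mul_eigenCoord_eq_zero (hW : W.IsHermitian) {v : ι → ℂ}
    (hv : ∀ i, 0 < hW.eigenvalues i → eigenCoord hW v i = 0)
    (h : 0 ≤ (star v ⬝ᵥ W.mulVec v).re) (i : ι) :
    hW.eigenvalues i * eigenCoord hW v i = 0 := by
  rw [re_dotProduct_mulVec hW] at h
  have hterm : ∀ j ∈ Finset.univ,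
      hW.eigenvalues j * Complex.normSq (eigenCoord hW v j) ≤ 0 := fun j _ => by
    rcases lt_or_ge 0 (hW.eigenvalues j) with hj | hj
    · simp [hv j hj]
    · exact mul_nonpos_of_nonpos_of_nonneg hj (Complex.normSq_nonneg _)
  have hzero := (Finset.sum_eq_zero_iff_of_nonpos hterm).1
    (le_antisymm (Finset.sum_nonpos hterm) h) i (Finset.mem_univ i)
  rcases mul_eq_zero.1 hzero with h0 | h0
  · simp [h0]
  · simp [Complex.normSq_eq_zero.1 h0]

lemma mulVec_eq_zero_of_nonneg (hW : W.IsHermitian) {v : ι → ℂ}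
    (hv : ∀ i, 0 < hW.eigenvalues i → eigenCoord hW v i = 0)
    (h : 0 ≤ (star v ⬝ᵥ W.mulVec v).re) : W.mulVec v = 0 :=
  eigenCoord_injective hW <| funext fun i => by
    rw [eigenCoord_mulVec, eigenvalues_mul_eigenCoord_eq_zero hW hv h, map_zero, Pi.zero_apply]

lemma eq_zero_of_nonneg (hW : W.IsHermitian) {v : ι → ℂ}
    (hv : ∀ i, 0 ≤ hW.eigenvalues i → eigenCoord hW v i = 0)
    (h : 0 ≤ (star v ⬝ᵥ W.mulVec v).re) : v = 0 :=
  eigenCoord_injective hW <| funext fun i => by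
    rw [map_zero, Pi.zero_apply]
    rcases le_or_gt 0 (hW.eigenvalues i) with hi | hi
    · exact hv i hi
    · refine (mul_eq_zero.1 (eigenvalues_mul_eigenCoord_eq_zero hW
        (fun j hj => hv j hj.le) h i)).resolve_left ?_
      exact_mod_cast hi.ne

/-- Eigenvectors for different eigenvalues are orthogonal. -/
lemma eigenCoord_eq_zero_of_mem_eigenspace (hW : W.IsHermitian) {v : ι → ℂ} {μ : ℂ}
    (hv : v ∈ Module.End.eigenspace (Matrix.toLin' W) μ) {i : ι}
    (hi : (hW.eigenvalues i : ℂ) ≠ μ) : eigenCoord hW v i = 0 := by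
  rw [Module.End.mem_eigenspace_iff, Matrix.toLin'_apply] at hv
  have h := eigenCoord_mulVec hW v i
  rw [hv, map_smul, Pi.smul_apply, smul_eq_mul] at h
  exact (mul_eq_zero.1 (show ((hW.eigenvalues i : ℂ) - μ) * eigenCoord hW v i = 0 by
    linear_combination -h)).resolve_left (sub_ne_zero.2 hi)

/-- A subspace on which a Hermitian form is negative definite has dimension at most the number of
negative eigenvalues. -/
lemma finrank_le_card_neg (hW : W.IsHermitian) (S : Submodule ℂ (ι → ℂ))
    (hS : ∀ v ∈ S, v ≠ 0 → (star v ⬝ᵥ W.mulVec v).re < 0) :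
    Module.finrank ℂ S ≤ Nat.card {i // hW.eigenvalues i < 0} := by
  classical
  let g : S →ₗ[ℂ] ({i // hW.eigenvalues i < 0} → ℂ) :=
    (LinearMap.funLeft ℂ ℂ Subtype.val).comp ((eigenCoord hW).comp S.subtype)
  have hg : Function.Injective g := by
    rw [← LinearMap.ker_eq_bot, LinearMap.ker_eq_bot']
    intro v hv
    by_contra hne
    refine (hS v v.2 (by simpa using hne)).not_ge ?_
    rw [re_dotProduct_mulVec hW]
    refine Finset.sum_nonneg fun i _ => ?_
    rcases le_or_gt 0 (hW.eigenvalues i) with hi | hi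
    · exact mul_nonneg hi (Complex.normSq_nonneg _)
    · have : eigenCoord hW v i = 0 := congrFun hv ⟨i, hi⟩
      simp [this]
  simpa using LinearMap.finrank_le_finrank_of_injective hg

end EigenCoord

/-! ### Eigenvalue bounds for entanglement witnesses. -/

section Witness

variable {m n : ℕ} {W : Op m n}

lemma eigenCoord_eq_zero_of_mem_negEigenspace (hW : W.IsHermitian) {v : Fin m × Fin n → ℂ}
    (hv : v ∈ negEigenspace W) {i : Fin m × Fin n} (hi : 0 ≤ hW.eigenvalues i) :
    eigenCoord hW v i = 0 := by
  have hle : negEigenspace W ≤ LinearMap.ker ((LinearMap.proj i).comp (eigenCoord hW)) :=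
    iSup_le fun μ w hw => eigenCoord_eq_zero_of_mem_eigenspace hW hw
      (by exact_mod_cast (μ.2.trans_le hi).ne')
  exact hle hv

lemma eigenCoord_eq_zero_of_mem_nonposEigenspace (hW : W.IsHermitian) {v : Fin m × Fin n → ℂ}
    (hv : v ∈ nonposEigenspace W) {i : Fin m × Fin n} (hi : 0 < hW.eigenvalues i) :
    eigenCoord hW v i = 0 := by
  have hle : nonposEigenspace W ≤ LinearMap.ker ((LinearMap.proj i).comp (eigenCoord hW)) :=
    sup_le (fun w hw => eigenCoord_eq_zero_of_mem_negEigenspace hW hw hi.le)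
      fun w hw => eigenCoord_eq_zero_of_mem_eigenspace hW hw (by exact_mod_cast hi.ne')
  exact hle hv

theorem IsEntanglementWitness.mem_zeroEigenspace (hW : IsEntanglementWitness W)
    {v : Fin m × Fin n → ℂ} (hv : v ∈ nonposEigenspace W) (hp : IsProductVector v) :
    v ∈ zeroEigenspace W := by
  rw [zeroEigenspace, Module.End.mem_eigenspace_iff, Matrix.toLin'_apply, zero_smul]
  exact mulVec_eq_zero_of_nonneg hW.isHermitian
    (fun i hi => eigenCoord_eq_zero_of_mem_nonposEigenspace hW.isHermitian hv hi)
    (hW.product_nonneg v hp)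

theorem IsEntanglementWitness.isPureEntangled (hW : IsEntanglementWitness W)
    {v : Fin m × Fin n → ℂ} (hv : v ∈ negEigenspace W) (h0 : v ≠ 0) : IsPureEntangled v :=
  ⟨h0, fun hp => h0 <| eq_zero_of_nonneg hW.isHermitian
    (fun _ hi => eigenCoord_eq_zero_of_mem_negEigenspace hW.isHermitian hv hi)
    (hW.product_nonneg v hp)⟩

lemma IsEntanglementWitness.exists_eigenvalues_neg (hW : IsEntanglementWitness W) :
    ∃ i, hW.isHermitian.eigenvalues i < 0 := by
  by_contra! h
  exact hW.not_posSemidef (hW.isHermitian.posSemidef_iff_eigenvalues_nonneg.2 h)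

theorem IsEntanglementWitness.one_le_numNegEigenvalues (hW : IsEntanglementWitness W) :
    1 ≤ numNegEigenvalues hW.isHermitian := by
  obtain ⟨i, hi⟩ := hW.exists_eigenvalues_neg
  have : Nonempty {i // hW.isHermitian.eigenvalues i < 0} := ⟨i, hi⟩
  exact Nat.card_pos

lemma card_nonneg_add_numNegEigenvalues (hW : W.IsHermitian) :
    Fintype.card {i // ¬ hW.eigenvalues i < 0} + numNegEigenvalues hW = m * n := by
  rw [numNegEigenvalues, Nat.card_eq_fintype_card, add_comm, Fintype.card_subtype_compl]
  have := Fintype.card_subtype_le fun i => hW.eigenvalues i < 0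
  rw [Nat.add_sub_cancel' this]
  simp

theorem IsEntanglementWitness.numNegEigenvalues_le (hW : IsEntanglementWitness W) :
    numNegEigenvalues hW.isHermitian ≤ (m - 1) * (n - 1) := by
  obtain ⟨⟨i, j⟩, -⟩ := hW.exists_eigenvalues_neg
  obtain ⟨m, rfl⟩ := Nat.exists_eq_succ_of_ne_zero (Fin.pos i).ne'
  obtain ⟨n, rfl⟩ := Nat.exists_eq_succ_of_ne_zero (Fin.pos j).ne'
  by_contra! hlt
  have hcard := card_nonneg_add_numNegEigenvalues hW.isHermitian
  simp only [Nat.succ_eq_add_one, Nat.add_sub_cancel] at hlt hcard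
  have hexp : (m + 1) * (n + 1) = m * n + (m + n + 1) := by ring
  -- The linear forms are the coordinates at nonnegative eigenvalues, at most `m + n` in the shifted
  -- dimensions `m + 1`, `n + 1`.
  obtain ⟨a, b, hab, hzero⟩ := exists_rank_one_common_zero (Nat.succ_pos m) (Nat.succ_pos n)
    (ι := {i // ¬ hW.isHermitian.eigenvalues i < 0}) (by simp only [Nat.succ_eq_add_one]; omega)
    fun i p => star (hW.isHermitian.eigenvectorBasis i p)
  refine hab (eq_zero_of_nonneg hW.isHermitian (fun i hi => ?_)
    (hW.product_nonneg _ ⟨a, b, rfl⟩))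
  rw [eigenCoord_eq_sum]
  exact hzero ⟨i, not_lt.2 hi⟩

/-- A linear functional vanishing on the product vectors on which another functional vanishes is a
multiple of it. -/
lemma exists_eq_smul_of_vanish_on_product {β ℓ : (Fin m × Fin n → ℂ) →ₗ[ℂ] ℂ}
    (h : ∀ a b, β (tensorVec a b) = 0 → ℓ (tensorVec a b) = 0) : ∃ c : ℂ, ℓ = c • β := by
  have hext : ∀ f : (Fin m × Fin n → ℂ) →ₗ[ℂ] ℂ, (∀ a b, f (tensorVec a b) = 0) → f = 0 := by
    intro f hf
    refine LinearMap.pi_ext' fun p => LinearMap.ext_ring ?_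
    have hp : tensorVec (Pi.single p.1 1) (Pi.single p.2 1) = Pi.single p (1 : ℂ) := by
      ext q
      simp only [tensorVec, Pi.single_apply, Prod.ext_iff]
      split_ifs <;> simp_all
    simpa [hp] using hf (Pi.single p.1 1) (Pi.single p.2 1)
  by_cases hβ : ∀ a b, β (tensorVec a b) = 0
  · exact ⟨0, by rw [zero_smul]; exact hext ℓ fun a b => h a b (hβ a b)⟩
  push Not at hβ
  obtain ⟨a₀, b₀, h₀⟩ := hβ
  have hadd : ∀ (f : (Fin m × Fin n → ℂ) →ₗ[ℂ] ℂ) a b (s t : ℂ),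
      f (tensorVec (a + t • a₀) (b + s • b₀)) = f (tensorVec a b) + t * f (tensorVec a₀ b) +
        s * f (tensorVec a b₀) + t * s * f (tensorVec a₀ b₀) := by
    intro f a b s t
    rw [show tensorVec (a + t • a₀) (b + s • b₀) = tensorVec a b + t • tensorVec a₀ b +
      s • tensorVec a b₀ + (t * s) • tensorVec a₀ b₀ by
        ext p; simp [tensorVec]; ring]
    simp
  have haddr : ∀ (f : (Fin m × Fin n → ℂ) →ₗ[ℂ] ℂ) a b (s : ℂ),
      f (tensorVec a (b + s • b₀)) = f (tensorVec a b) + s * f (tensorVec a b₀) := by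
    intro f a b s
    rw [show tensorVec a (b + s • b₀) = tensorVec a b + s • tensorVec a b₀ by
      ext p; simp [tensorVec]; ring]
    simp
  have haddl : ∀ (f : (Fin m × Fin n → ℂ) →ₗ[ℂ] ℂ) a b (t : ℂ),
      f (tensorVec (a + t • a₀) b) = f (tensorVec a b) + t * f (tensorVec a₀ b) := by
    intro f a b t
    rw [show tensorVec (a + t • a₀) b = tensorVec a b + t • tensorVec a₀ b by
      ext p; simp [tensorVec]; ring]
    simp
  -- This `c` makes `ℓ - c • β` vanish at `a₀ ⊗ b₀` too, so shifts along `a₀` or `b₀` can move a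
  -- product vector into `ker β` without changing the value of `ℓ - c • β`.
  set c : ℂ := ℓ (tensorVec a₀ b₀) / β (tensorVec a₀ b₀) with hc
  refine ⟨c, sub_eq_zero.1 (hext _ ?_)⟩
  set f := ℓ - c • β with hf
  have hfβ : ∀ a b, β (tensorVec a b) = 0 → f (tensorVec a b) = 0 := fun a b hab => by
    simp [hf, hab, h a b hab]
  have hf₀ : f (tensorVec a₀ b₀) = 0 := by simp [hf, hc, h₀]
  have hfr : ∀ b, f (tensorVec a₀ b) = 0 := fun b => by
    have := hfβ a₀ (b + (-(β (tensorVec a₀ b) / β (tensorVec a₀ b₀))) • b₀) (by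
      rw [haddr]; field_simp; ring)
    rwa [haddr, hf₀, mul_zero, add_zero] at this
  have hfl : ∀ a, f (tensorVec a b₀) = 0 := fun a => by
    have := hfβ (a + (-(β (tensorVec a b₀) / β (tensorVec a₀ b₀))) • a₀) b₀ (by
      rw [haddl]; field_simp; ring)
    rwa [haddl, hf₀, mul_zero, add_zero] at this
  intro a b
  -- Shifting `a` by `t • a₀` ensures that `β` varies along `b₀`, so a further shift of `b` reaches
  -- `ker β`.
  obtain ⟨t, ht⟩ : ∃ t : ℂ, β (tensorVec a b₀) + t * β (tensorVec a₀ b₀) ≠ 0 :=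
    ⟨(1 - β (tensorVec a b₀)) / β (tensorVec a₀ b₀), by
      rw [div_mul_cancel₀ _ h₀]; simp⟩
  have := hfβ (a + t • a₀) (b + (-(β (tensorVec a b) + t * β (tensorVec a₀ b)) /
    (β (tensorVec a b₀) + t * β (tensorVec a₀ b₀))) • b₀) (by
      rw [hadd]; field_simp; ring)
  rwa [hadd, hfr, hfl, hf₀, mul_zero, mul_zero, mul_zero, add_zero, add_zero, add_zero] at this

theorem IsEntanglementWitness.two_le_numPosEigenvalues (hW : IsEntanglementWitness W) :
    2 ≤ numPosEigenvalues hW.isHermitian := by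
  by_contra! hlt
  obtain ⟨i, hi⟩ := hW.exists_eigenvalues_neg
  set hH := hW.isHermitian
  let e := fun k => (LinearMap.proj k).comp (eigenCoord hH)
  -- `β` is the coordinate at the only positive eigenvalue, or zero if there is none.
  obtain ⟨β, hβi, hβ⟩ : ∃ β : (Fin m × Fin n → ℂ) →ₗ[ℂ] ℂ, β (hH.eigenvectorBasis i) = 0 ∧
      ∀ v, β v = 0 → ∀ k, 0 < hH.eigenvalues k → eigenCoord hH v k = 0 := by
    have hsub : Subsingleton {k // 0 < hH.eigenvalues k} :=
      Finite.card_le_one_iff_subsingleton.1 (Nat.lt_succ_iff.1 hlt)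
    by_cases hex : ∃ k, 0 < hH.eigenvalues k
    · obtain ⟨k, hk⟩ := hex
      refine ⟨e k, ?_, fun v hv l hl => ?_⟩
      · have hki : k ≠ i := fun h => (hi.trans (h ▸ hk)).false
        simp [e, eigenCoord_eigenvectorBasis, hki]
      · have : l = k := congrArg Subtype.val (Subsingleton.elim
          (⟨l, hl⟩ : {k // 0 < hH.eigenvalues k}) ⟨k, hk⟩)
        exact this ▸ hv
    · exact ⟨0, rfl, fun v _ k hk => (hex ⟨k, hk⟩).elim⟩
  obtain ⟨c, hc⟩ := exists_eq_smul_of_vanish_on_product (β := β) (ℓ := e i) fun a b hab => by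
    refine (mul_eq_zero.1 (eigenvalues_mul_eigenCoord_eq_zero hH (hβ _ hab)
      (hW.product_nonneg _ ⟨a, b, rfl⟩) i)).resolve_left ?_
    exact_mod_cast hi.ne
  have := LinearMap.congr_fun hc (hH.eigenvectorBasis i)
  simp [e, eigenCoord_eigenvectorBasis, hβi] at this

theorem IsEntanglementWitness.numPosEigenvalues_le (hW : IsEntanglementWitness W) :
    numPosEigenvalues hW.isHermitian ≤ m * n - 1 := by
  obtain ⟨i, hi⟩ := hW.exists_eigenvalues_neg
  have h : Fintype.card {k // 0 < hW.isHermitian.eigenvalues k} < Fintype.card (Fin m × Fin n) :=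
    Fintype.card_subtype_lt (x := i) hi.le.not_gt
  rw [numPosEigenvalues, Nat.card_eq_fintype_card]
  simp only [Fintype.card_prod, Fintype.card_fin] at h
  omega

end Witness

/-! ### A decomposable witness attaining the bound. -/

section Decomposable

variable {m n : ℕ}

/-- On product vectors, transposing the first factor amounts to conjugating `a`; hence `Q^Γ`
inherits nonnegativity there from `Q`. -/
lemma dotProduct_partialTranspose (Q : Op m n) (a : Fin m → ℂ) (b : Fin n → ℂ) :
    star (tensorVec a b) ⬝ᵥ (partialTranspose Q).mulVec (tensorVec a b) =
      star (tensorVec (star a) b) ⬝ᵥ Q.mulVec (tensorVec (star a) b) := by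
  simp only [dotProduct, Matrix.mulVec, Finset.mul_sum]
  simp only [← Fintype.sum_prod_type']
  refine Fintype.sum_bijective
    (fun x : (Fin m × Fin n) × (Fin m × Fin n) => ((x.2.1, x.1.2), (x.1.1, x.2.2)))
    (Function.Involutive.bijective fun x => rfl) _ _ fun x => ?_
  simp [tensorVec, partialTranspose]
  ring

lemma IsDecomposable.product_nonneg {W : Op m n} (hW : IsDecomposable W)
    {v : Fin m × Fin n → ℂ} (hv : IsProductVector v) :
    0 ≤ (star v ⬝ᵥ W.mulVec v).re := by
  obtain ⟨P, Q, hP, hQ, rfl⟩ := hW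
  obtain ⟨a, b, rfl⟩ := hv
  rw [Matrix.add_mulVec, dotProduct_add, Complex.add_re, dotProduct_partialTranspose]
  exact add_nonneg (Complex.le_def.1 (hP.dotProduct_mulVec_nonneg _)).1
    (Complex.le_def.1 (hQ.dotProduct_mulVec_nonneg _)).1

lemma isHermitian_partialTranspose {Q : Op m n} (hQ : Q.IsHermitian) :
    (partialTranspose Q).IsHermitian :=
  Matrix.IsHermitian.ext fun _ _ => hQ.apply _ _

/-- A positive definite matrix dominates a positive multiple of the identity. -/
lemma exists_pos_posSemidef_sub_smul_one {ι : Type*} [Fintype ι] [DecidableEq ι] [Nonempty ι]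
    {H : Matrix ι ι ℂ} (hH : H.PosDef) :
    ∃ ε : ℝ, 0 < ε ∧ (H - (ε : ℂ) • (1 : Matrix ι ι ℂ)).PosSemidef := by
  have hh := hH.isHermitian
  obtain ⟨i, hi⟩ := Finite.exists_min hh.eigenvalues
  refine ⟨hh.eigenvalues i, hH.eigenvalues_pos i, ?_⟩
  have hherm : (H - (hh.eigenvalues i : ℂ) • (1 : Matrix ι ι ℂ)).IsHermitian := by
    refine hh.sub ?_
    rw [Matrix.IsHermitian, Matrix.conjTranspose_smul, Matrix.conjTranspose_one]
    simp
  refine Matrix.PosSemidef.of_dotProduct_mulVec_nonneg hherm fun v => ?_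
  refine Complex.le_def.2 ⟨?_, (hherm.im_star_dotProduct_mulVec_self v).symm⟩
  rw [Matrix.sub_mulVec, Matrix.smul_mulVec, Matrix.one_mulVec, dotProduct_sub, dotProduct_smul,
    Complex.sub_re, re_dotProduct_mulVec hh, smul_eq_mul, Complex.re_ofReal_mul,
    dotProduct_star_eq_eigenCoord hh, re_dotProduct_star_self, Finset.mul_sum, Complex.zero_re,
    sub_nonneg]
  exact Finset.sum_le_sum fun j _ => mul_le_mul_of_nonneg_right (hi j) (Complex.normSq_nonneg _)

/-- A factor of a matrix whose blocks along the diagonals of the index grid are Hankel matrices of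
moments. -/
noncomputable def momentFactor (m n : ℕ) :
    Matrix (Fin (m + n) × Fin (m + n)) (Fin m × Fin n) ℂ :=
  Matrix.of fun x p =>
    if (p.1 : ℕ) + n = p.2 + x.2 then ((x.1 : ℕ) : ℂ) ^ ((p.1 : ℕ) + p.2) else 0

/-- The index `x.2` selects one diagonal of the grid, the shift by `n` keeping it a natural number.
Along a diagonal the exponents `p.1 + p.2` are distinct and below `m + n`, so a Vandermonde system
at the nodes `0, …, m + n - 1` recovers the vector. -/
lemma momentFactor_mulVec_injective :
    Function.Injective (momentFactor m n).mulVec := by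
  suffices h : ∀ v, (momentFactor m n).mulVec v = 0 → v = 0 by
    intro v w hvw
    exact sub_eq_zero.1 (h _ (by rw [Matrix.mulVec_sub]; exact sub_eq_zero.2 hvw))
  intro v hv
  ext p
  have hp1 := p.1.isLt
  have hp2 := p.2.isLt
  let d : Fin (m + n) := ⟨p.1 + n - p.2, by omega⟩
  let w : Fin (m + n) → ℂ := fun t =>
    ∑ q : Fin m × Fin n,
      if (q.1 : ℕ) + n = q.2 + d ∧ (q.1 : ℕ) + q.2 = t then v q else 0
  have hw : w = 0 := by
    refine Matrix.eq_zero_of_forall_index_sum_pow_mul_eq_zero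
      (f := fun k : Fin (m + n) => ((k : ℕ) : ℂ))
      (fun k l h => Fin.ext (Nat.cast_injective h)) fun k => ?_
    refine Eq.trans ?_ (congrFun hv (k, d))
    simp only [w, Finset.mul_sum, Matrix.mulVec, dotProduct, momentFactor, Matrix.of_apply]
    rw [Finset.sum_comm]
    refine Finset.sum_congr rfl fun q _ => ?_
    rw [Finset.sum_eq_single (⟨q.1 + q.2, by omega⟩ : Fin (m + n))]
    · by_cases h : (q.1 : ℕ) + n = q.2 + d <;> simp [h]
    · intro t _ ht
      rw [if_neg fun h => ht (Fin.ext h.2.symm), mul_zero]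
    · simp
  have hwp := congrFun hw ⟨p.1 + p.2, by omega⟩
  simp only [w, d] at hwp
  rw [Finset.sum_eq_single p] at hwp
  · rw [if_pos ⟨by omega, rfl⟩] at hwp
    exact hwp
  · intro q _ hq
    refine if_neg fun h => hq (Prod.ext (Fin.ext ?_) (Fin.ext ?_)) <;> omega
  · simp

/-- The Gram matrix of the columns of `momentFactor`. -/
noncomputable def momentGram (m n : ℕ) : Op m n :=
  (momentFactor m n).conjTranspose * momentFactor m n

/-- Swapping `p.1` and `q.1` preserves the exponent but turns the equal-diagonal condition into an
equal-antidiagonal one. -/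
lemma momentGram_apply (p q : Fin m × Fin n) :
    momentGram m n p q = if (p.1 : ℕ) + q.2 = q.1 + p.2 then
      ∑ k : Fin (m + n), ((k : ℕ) : ℂ) ^ ((p.1 : ℕ) + p.2 + q.1 + q.2) else 0 := by
  have hp1 := p.1.isLt
  have hp2 := p.2.isLt
  simp only [momentGram, Matrix.mul_apply, Fintype.sum_prod_type, Matrix.conjTranspose_apply,
    momentFactor, Matrix.of_apply]
  split_ifs with h
  · refine Finset.sum_congr rfl fun k _ => ?_
    rw [Finset.sum_eq_single (⟨p.1 + n - p.2, by omega⟩ : Fin (m + n))]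
    · rw [if_pos (by simp only; omega), if_pos (by simp only; omega)]
      simp only [star_pow, star_natCast]
      ring
    · intro d _ hd
      rw [if_neg, star_zero, zero_mul]
      intro h'
      exact hd (Fin.ext (by simp only; omega))
    · simp
  · refine Finset.sum_eq_zero fun k _ => Finset.sum_eq_zero fun d _ => ?_
    by_cases h1 : (p.1 : ℕ) + n = p.2 + d
    · rw [if_neg (c := (q.1 : ℕ) + n = q.2 + d) (by omega), mul_zero]
    · rw [if_neg h1, star_zero, zero_mul]

/-- The sums of a vector along the antidiagonals of the index grid. -/
noncomputable def antidiagonalSums (m n : ℕ) : (Fin m × Fin n → ℂ) →ₗ[ℂ] (Fin (m + n - 1) → ℂ) :=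
  Matrix.mulVecLin (Matrix.of fun s p => if (p.1 : ℕ) + p.2 = s then 1 else 0)

lemma mul_le_finrank_ker_antidiagonalSums (hm : 1 ≤ m) (hn : 1 ≤ n) :
    (m - 1) * (n - 1) ≤ Module.finrank ℂ (LinearMap.ker (antidiagonalSums m n)) := by
  have h := LinearMap.finrank_range_add_finrank_ker (antidiagonalSums m n)
  have h' := Submodule.finrank_le (LinearMap.range (antidiagonalSums m n))
  simp only [Module.finrank_fintype_fun_eq_card, Fintype.card_prod, Fintype.card_fin] at h h'
  obtain ⟨m, rfl⟩ := Nat.exists_eq_add_of_le' hm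
  obtain ⟨n, rfl⟩ := Nat.exists_eq_add_of_le' hn
  have hexp : (m + 1) * (n + 1) = m * n + (m + n + 1) := by ring
  simp only [Nat.add_sub_cancel]
  omega

/-- After partial transposition each antidiagonal block is constant, with exponent `2 * (p.1 +
p.2)`, so it sees only the antidiagonal sum of `v`; the identity is its own partial transpose. -/
lemma partialTranspose_momentGram_sub_mulVec (ε : ℂ) {v : Fin m × Fin n → ℂ}
    (hv : antidiagonalSums m n v = 0) :
    (partialTranspose (momentGram m n - ε • 1)).mulVec v = (-ε) • v := by
  have hsplit : partialTranspose (momentGram m n - ε • 1) =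
      partialTranspose (momentGram m n) - ε • 1 := by
    ext p q
    have : q.1 = p.1 ∧ p.2 = q.2 ↔ p = q := by
      rw [Prod.ext_iff, eq_comm (a := q.1)]
    simp [partialTranspose, Matrix.one_apply, this]
  rw [hsplit, Matrix.sub_mulVec, Matrix.smul_mulVec, Matrix.one_mulVec, neg_smul, sub_eq_neg_self]
  ext p
  have hp1 := p.1.isLt
  have hp2 := p.2.isLt
  have hs := congrFun hv ⟨p.1 + p.2, by omega⟩
  simp only [antidiagonalSums, Matrix.mulVecLin_apply, Matrix.mulVec, dotProduct, Matrix.of_apply,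
    Pi.zero_apply] at hs ⊢
  rw [← mul_zero (∑ k : Fin (m + n), ((k : ℕ) : ℂ) ^ (2 * ((p.1 : ℕ) + p.2))), ← hs,
    Finset.mul_sum]
  refine Finset.sum_congr rfl fun q _ => ?_
  simp only [partialTranspose, Matrix.of_apply, momentGram_apply]
  by_cases h : (q.1 : ℕ) + q.2 = p.1 + p.2
  · rw [if_pos h, if_pos h, one_mul,
      show (q.1 : ℕ) + p.2 + p.1 + q.2 = 2 * ((p.1 : ℕ) + p.2) by omega]
  · rw [if_neg h, if_neg h, zero_mul, mul_zero]

theorem exists_decomposable_numNegEigenvalues_eq (hm : 2 ≤ m) (hn : 2 ≤ n) :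
    ∃ (W : Op m n) (hW : IsEntanglementWitness W), IsDecomposable W ∧
      numNegEigenvalues hW.isHermitian = (m - 1) * (n - 1) := by
  have : Nonempty (Fin m × Fin n) := ⟨⟨0, by omega⟩, ⟨0, by omega⟩⟩
  have hpos : (momentGram m n).PosDef :=
    Matrix.PosDef.conjTranspose_mul_self _ momentFactor_mulVec_injective
  obtain ⟨ε, hε, hQ⟩ := exists_pos_posSemidef_sub_smul_one hpos
  set W := partialTranspose (momentGram m n - (ε : ℂ) • 1) with hWdef
  have hdec : IsDecomposable W := ⟨0, _, Matrix.PosSemidef.zero, hQ, (zero_add _).symm⟩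
  have hherm : W.IsHermitian := isHermitian_partialTranspose hQ.isHermitian
  have hge : (m - 1) * (n - 1) ≤ numNegEigenvalues hherm := by
    refine (mul_le_finrank_ker_antidiagonalSums (by omega) (by omega)).trans
      (finrank_le_card_neg hherm _ fun v hv hv0 => ?_)
    rw [hWdef, partialTranspose_momentGram_sub_mulVec _ hv, dotProduct_smul, smul_eq_mul,
      ← Complex.ofReal_neg, Complex.re_ofReal_mul, re_dotProduct_star_self]
    obtain ⟨p, hp⟩ := Function.ne_iff.1 hv0
    exact mul_neg_of_neg_of_pos (neg_lt_zero.2 hε) (Finset.sum_pos'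
      (fun i _ => Complex.normSq_nonneg _) ⟨p, Finset.mem_univ p, Complex.normSq_pos.2 hp⟩)
  have hW : IsEntanglementWitness W := by
    refine ⟨hherm, fun hpsd => ?_, fun v hv => hdec.product_nonneg hv⟩
    have h1 : 0 < (m - 1) * (n - 1) := Nat.mul_pos (by omega) (by omega)
    have h2 : 0 < numNegEigenvalues hherm := h1.trans_le hge
    obtain ⟨⟨i, hi⟩⟩ := (Nat.card_pos_iff.1 h2).1
    exact hi.not_ge (hpsd.eigenvalues_nonneg i)
  exact ⟨W, hW, hdec, le_antisymm hW.numNegEigenvalues_le hge⟩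

end Decomposable

end EntWit

theorem mainTheorem4 (m n : ℕ) :
    (∀ (W : EntWit.Op m n) (hW : EntWit.IsEntanglementWitness W),
      (∀ v ∈ EntWit.nonposEigenspace W, EntWit.IsProductVector v →
        v ∈ EntWit.zeroEigenspace W) ∧
      (∀ v ∈ EntWit.negEigenspace W, v ≠ 0 → EntWit.IsPureEntangled v) ∧
      EntWit.numNegEigenvalues hW.isHermitian ∈ Set.Icc 1 ((m - 1) * (n - 1)) ∧
      EntWit.numPosEigenvalues hW.isHermitian ∈ Set.Icc 2 (m * n - 1)) ∧
    (2 ≤ m → 2 ≤ n →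
      ∃ (W : EntWit.Op m n) (hW : EntWit.IsEntanglementWitness W),
        EntWit.IsDecomposable W ∧
        EntWit.numNegEigenvalues hW.isHermitian = (m - 1) * (n - 1)) :=
  ⟨fun _ hW => ⟨fun _ hv hp => hW.mem_zeroEigenspace hv hp,
    fun _ hv h0 => hW.isPureEntangled hv h0,
    ⟨hW.one_le_numNegEigenvalues, hW.numNegEigenvalues_le⟩,
    ⟨hW.two_le_numPosEigenvalues, hW.numPosEigenvalues_le⟩⟩,
    fun hm hn => EntWit.exists_decomposable_numNegEigenvalues_eq hm hn⟩
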